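/- Let $\mathcal H=\{(i,j)\in\mathbb Z^2 : i+j-1\ge 1\}$, where $(i,j)$ is the position in row $i$ and column $j$, rows being numbered downwards and columns rightwards. A *pipe dream* is a finite subset of $\mathcal H$. A *super pipe dream* is a pair $\mathbf P=(P_x,P_y)$ of (not necessarily disjoint) pipe dreams, viewed as a placement of black checkers at the positions in $P_x$ and red checkers at the positions in $P_y$. Its *adjoint* is $\mathbf P^\dagger=(P_y^t,P_x^t)$, where $P^t=\{(j,i):(i,j)\in P\}$, and its *shift* is $\sigma(\mathbf P)=(\sigma(P_x),\sigma(P_y))$, where $\sigma(P)=\{(i+1,j-1):(i,j)\in P\}$. For $j\in\mathbb Z$ and a super pipe dream $\mathbf P$ with no red checkers in column $j+1$, define $Y_j^+\mathbf P$ by repeating the following until column $j$ contains no red checker. Let $(i,j)$ be the position of the lowest red checker in column $j$. * If there is no checker at $(i,j+1)$, let $(i',j)$ be the first position of $\mathbb Z^2$ above $(i,j)$ with no checkers. Move the red checker at $(i,j)$ to $(i',j+1)$, and for each row $r$ with $i'<r<i$ exchange the checker(s) at $(r,j)$ with the checker(s), if any, at $(r,j+1)$. * If there is a checker at $(i,j+1)$,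 exchange the checker(s) at $(i,j)$ with the checker at $(i,j+1)$. For every super pipe dream $\mathbf P$ set $Y^+\mathbf P=Y_m^+Y_{m+1}^+\cdots Y_M^+\mathbf P$ (the rightmost operator is applied first), where $m\le M$ are such that all red checkers of $\mathbf P$ lie in columns $m,\dots,M$. Symmetrically, for a super pipe dream $\mathbf P$ with no black checkers in row $i+1$ set $X_i^+\mathbf P=(Y_i^+(\mathbf P^\dagger))^\dagger$, and for every super pipe dream $\mathbf P$ set $X^+\mathbf P=X_m^+X_{m+1}^+\cdots X_M^+\mathbf P$, where $m\le M$ are such that all black checkers of $\mathbf P$ lie in rows $m,\dots,M$. (The results do not depend on the choice of $m$ and $M$.) **Proposition 5.1.** For every super pipe dream $\mathbf P$, $$\sigma(Y^+\mathbf P)=X^+\mathbf P$$ as super pipe dreams, i.e. both the black and the red checkers occupy the same positions on the two sides. -/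

import Mathlib

/-- The half-space `ℋ = {(i, j) ∈ ℤ² | i + j - 1 ≥ 1}`.  A position `(i, j)` is the tile in row `i`
and column `j`; row indices increase downwards and column indices increase rightwards. -/
def halfSpace : Set (ℤ × ℤ) := {p | 1 ≤ p.1 + p.2 - 1}

/-- A (single) pipe dream: a finite subset of the half-space `ℋ`. -/
@[ext]
structure PipeDream where
  cells : Finset (ℤ × ℤ)
  subset : ∀ p ∈ cells, p ∈ halfSpace

namespace PipeDream

/-- The image of a pipe dream under a map of positions that keeps its checkers inside `ℋ`. -/
def move (P : PipeDream) (f : ℤ × ℤ → ℤ × ℤ) (hf : ∀ p ∈ P.cells, f p ∈ halfSpace) :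
    PipeDream where
  cells := P.cells.image f
  subset := by
    intro q hq
    obtain ⟨p, hp, rfl⟩ := Finset.mem_image.1 hq
    exact hf p hp

/-- The transpose `Pᵗ = {(j, i) | (i, j) ∈ P}`. -/
def transpose (P : PipeDream) : PipeDream :=
  P.move (fun p => (p.2, p.1)) (by
    intro p hp
    have h := P.subset p hp
    simp only [halfSpace, Set.mem_ofPred_eq] at h ⊢
    omega)

/-- The shift `σ(P) = {(i + 1, j - 1) | (i, j) ∈ P}`. -/
def shift (P : PipeDream) : PipeDream :=
  P.move (fun p => (p.1 + 1, p.2 - 1)) (by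
    intro p hp
    have h := P.subset p hp
    simp only [halfSpace, Set.mem_ofPred_eq] at h ⊢
    omega)

end PipeDream

/-- A super pipe dream `𝐏 = (P_x, P_y)`: a pair of pipe dreams, not necessarily disjoint.
The set `P_x` holds the positions of the black checkers, `P_y` those of the red checkers. -/
@[ext]
structure SuperPipeDream where
  black : PipeDream
  red : PipeDream

namespace SuperPipeDream

/-- The adjoint `𝐏† = (P_yᵗ, P_xᵗ)`. -/
def adjoint (P : SuperPipeDream) : SuperPipeDream := ⟨P.red.transpose, P.black.transpose⟩

/-- The shift `σ(𝐏) = (σ(P_x), σ(P_y))`. -/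
def shift (P : SuperPipeDream) : SuperPipeDream := ⟨P.black.shift, P.red.shift⟩

/-- The positions that hold at least one checker. -/
def occupied (P : SuperPipeDream) : Finset (ℤ × ℤ) := P.black.cells ∪ P.red.cells

/-- Every occupied position lies in `ℋ`. -/
theorem mem_halfSpace_of_mem_occupied (P : SuperPipeDream) {p : ℤ × ℤ} (hp : p ∈ P.occupied) :
    p ∈ halfSpace := by
  rcases Finset.mem_union.1 hp with h | h
  · exact P.black.subset p h
  · exact P.red.subset p h

/-- Above every position there is, in the same column, a position of `ℤ²` without checkers. -/
theorem exists_empty_above (P : SuperPipeDream) (i j : ℤ) :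
    ∃ d : ℕ, (i - (d + 1), j) ∉ P.occupied := by
  refine ⟨(i + j).toNat, fun h => ?_⟩
  have h' := P.mem_halfSpace_of_mem_occupied h
  simp only [halfSpace, Set.mem_ofPred_eq] at h'
  omega

/-- The row `i' < i` of the first position `(i', j)` strictly above `(i, j)` with no checkers. -/
def emptyRowAbove (P : SuperPipeDream) (i j : ℤ) : ℤ :=
  i - (Nat.find (P.exists_empty_above i j) + 1)

/-- The positions strictly between `(i, j)` and the first empty position above it are occupied. -/
theorem mem_occupied_of_between (P : SuperPipeDream) {i j r : ℤ} (h₁ : P.emptyRowAbove i j < r)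
    (h₂ : r < i) : (r, j) ∈ P.occupied := by
  unfold emptyRowAbove at h₁
  have h := Nat.find_min (P.exists_empty_above i j) (m := (i - r - 1).toNat) (by omega)
  have e : i - (((i - r - 1).toNat : ℤ) + 1) = r := by omega
  rw [e] at h
  exact not_not.1 h

/-- On positions whose row satisfies `R`, exchange columns `j` and `j + 1`; fix all others. -/
def swapColumns (j : ℤ) (R : ℤ → Prop) [DecidablePred R] (p : ℤ × ℤ) : ℤ × ℤ :=
  if R p.1 ∧ p.2 = j then (p.1, j + 1)
  else if R p.1 ∧ p.2 = j + 1 then (p.1, j)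
  else p

/-- `swapColumns` keeps a position of `ℋ` inside `ℋ` if `(r, j) ∈ ℋ` for each row `r` in `R`. -/
theorem swapColumns_mem_halfSpace {j : ℤ} {R : ℤ → Prop} [DecidablePred R]
    (hR : ∀ r, R r → (r, j) ∈ halfSpace) {p : ℤ × ℤ} (hp : p ∈ halfSpace) :
    swapColumns j R p ∈ halfSpace := by
  unfold swapColumns
  split_ifs with h₁ h₂
  · have := hR p.1 h₁.1
    simp only [halfSpace, Set.mem_ofPred_eq] at this ⊢
    omega
  · exact hR p.1 h₂.1
  · exact hp

/-- The modification of the `1`-ladder `{(i, j), (i, j + 1)}`: exchange the checker(s) at `(i, j)`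
with those at `(i, j + 1)`. -/
def flowSmallLadder (P : SuperPipeDream) (i j : ℤ) (h : (i, j) ∈ P.red.cells) : SuperPipeDream where
  black := P.black.move (swapColumns j (fun r => r = i)) (fun _ hp =>
    swapColumns_mem_halfSpace (by rintro _ rfl; exact P.red.subset _ h) (P.black.subset _ hp))
  red := P.red.move (swapColumns j (fun r => r = i)) (fun _ hp =>
    swapColumns_mem_halfSpace (by rintro _ rfl; exact P.red.subset _ h) (P.red.subset _ hp))

/-- The modification of the big ladder with SW corner `(i, j)` and NE corner `(i', j + 1)`, where
`(i', j)` is the first position above `(i, j)` with no checkers: the red checker at `(i, j)` moves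
to `(i', j + 1)`, and in each intermediate row the checkers on the left are exchanged with those on
the right.  (A black checker at `(i, j)` or `(i', j + 1)` stays in place.) -/
def flowBigLadder (P : SuperPipeDream) (i j : ℤ) (h : (i, j) ∈ P.red.cells) : SuperPipeDream where
  black := P.black.move (swapColumns j (fun r => P.emptyRowAbove i j < r ∧ r < i)) (fun _ hp =>
    swapColumns_mem_halfSpace
      (fun _ hr => P.mem_halfSpace_of_mem_occupied (P.mem_occupied_of_between hr.1 hr.2))
      (P.black.subset _ hp))
  red := P.red.move
    (fun p => if p = (i, j) then (P.emptyRowAbove i j, j + 1)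
      else swapColumns j (fun r => P.emptyRowAbove i j < r ∧ r < i) p) (fun p hp => by
    split_ifs with hpij
    · have hij : (P.emptyRowAbove i j + 1, j) ∈ halfSpace := by
        have hlt : P.emptyRowAbove i j < i := by unfold emptyRowAbove; omega
        rcases (show P.emptyRowAbove i j + 1 ≤ i by omega).lt_or_eq with hlt' | heq
        · exact P.mem_halfSpace_of_mem_occupied (P.mem_occupied_of_between (by omega) hlt')
        · rw [heq]; exact P.red.subset _ h
      simp only [halfSpace, Set.mem_ofPred_eq] at hij ⊢
      omega
    · exact swapColumns_mem_halfSpace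
        (fun _ hr => P.mem_halfSpace_of_mem_occupied (P.mem_occupied_of_between hr.1 hr.2))
        (P.red.subset _ hp))

/-- The rows of the red checkers in column `j`. -/
def redRows (P : SuperPipeDream) (j : ℤ) : Finset ℤ :=
  (P.red.cells.filter (fun p => p.2 = j)).image Prod.fst

theorem mem_red_of_mem_redRows (P : SuperPipeDream) {i j : ℤ} (h : i ∈ P.redRows j) :
    (i, j) ∈ P.red.cells := by
  obtain ⟨⟨a, b⟩, hp, rfl⟩ := Finset.mem_image.1 h
  obtain ⟨h₁, rfl⟩ := Finset.mem_filter.1 hp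
  exact h₁

/-- Treat the lowest red checker `(i, j)` of column `j`: flow in a big ladder if `(i, j + 1)` holds
no checker, and in the `1`-ladder otherwise.  If column `j` has no red checker, change nothing. -/
def flowLowest (j : ℤ) (P : SuperPipeDream) : SuperPipeDream :=
  if h : (P.redRows j).Nonempty then
    if ((P.redRows j).max' h, j + 1) ∉ P.occupied then
      P.flowBigLadder ((P.redRows j).max' h) j
        (P.mem_red_of_mem_redRows ((P.redRows j).max'_mem h))
    else
      P.flowSmallLadder ((P.redRows j).max' h) j
        (P.mem_red_of_mem_redRows ((P.redRows j).max'_mem h))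
  else P

/-- The operator `Y⁺_j`, meant for super pipe dreams with no red checkers in column `j + 1` (which
is the case each time it is used below): treat the lowest red checker remaining in column `j` until
none is left there.  Every round removes at least one red checker from column `j`, and a round does
nothing once the column has none, so as many rounds as there are red checkers suffice. -/
def flowRedStep (j : ℤ) (P : SuperPipeDream) : SuperPipeDream :=
  (flowLowest j)^[(P.redRows j).card] P

/-- The operator `X⁺_i 𝐏 = (Y⁺_i (𝐏†))†`, which flows the black checkers of row `i` into row
`i + 1`, where row `i + 1` is meant to have no black checkers. -/
def flowBlackStep (i : ℤ) (P : SuperPipeDream) : SuperPipeDream :=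
  (flowRedStep i P.adjoint).adjoint

/-- `composeSteps T j n = T j ∘ T (j + 1) ∘ ⋯ ∘ T (j + n - 1)`. -/
def composeSteps (T : ℤ → SuperPipeDream → SuperPipeDream) (j : ℤ) :
    ℕ → SuperPipeDream → SuperPipeDream
  | 0, P => P
  | n + 1, P => T j (composeSteps T (j + 1) n P)

/-- A number `N` such that all red checkers lie in the columns `-N, …, N`. -/
def redBound (P : SuperPipeDream) : ℕ := P.red.cells.sup (fun p => p.2.natAbs)

/-- A number `N` such that all black checkers lie in the rows `-N, …, N`. -/
def blackBound (P : SuperPipeDream) : ℕ := P.black.cells.sup (fun p => p.1.natAbs)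

/-- `Y⁺_{≥ j} 𝐏 = Y⁺_j Y⁺_{j+1} ⋯ Y⁺_M 𝐏`, where all red checkers of `𝐏` lie in or west of column
`M` (here `M = redBound`; steps in columns without red checkers change nothing). -/
def flowRedFrom (j : ℤ) (P : SuperPipeDream) : SuperPipeDream :=
  composeSteps flowRedStep j ((P.redBound : ℤ) + 1 - j).toNat P

/-- `X⁺_{≥ i} 𝐏 = X⁺_i X⁺_{i+1} ⋯ X⁺_M 𝐏`, where all black checkers of `𝐏` lie in or above row
`M` (here `M = blackBound`). -/
def flowBlackFrom (i : ℤ) (P : SuperPipeDream) : SuperPipeDream :=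
  composeSteps flowBlackStep i ((P.blackBound : ℤ) + 1 - i).toNat P

/-- `Y⁺ 𝐏 = Y⁺_{≥ m} 𝐏`, where all red checkers of `𝐏` lie in or east of column `m`
(here `m = -redBound`): every red checker flows one column to the right. -/
def flowRed (P : SuperPipeDream) : SuperPipeDream := flowRedFrom (-(P.redBound : ℤ)) P

/-- `X⁺ 𝐏 = X⁺_{≥ m} 𝐏`, where all black checkers of `𝐏` lie in or below row `m`
(here `m = -blackBound`): every black checker flows one row down. -/
def flowBlack (P : SuperPipeDream) : SuperPipeDream := flowBlackFrom (-(P.blackBound : ℤ)) P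

end SuperPipeDream

/-!
The flow `Y⁺` is a vertex model, and its local rule is symmetric under exchange of the two colours.

Treating column `j` amounts to reading its cells from below to above with one bit of memory, which
says whether a red checker is being carried in a big ladder.  What cell `(i, j)` does depends only on
its own checkers, on this bit `v`, and on whether `(i, j + 1)` then holds a black checker (a bit `h`
entering from the right); there is no red checker at `(i, j + 1)`, because column `j + 1` has been
treated before.  It produces a new bit `v` for the cell above, the final contents of `(i, j + 1)`,
and a black checker or none at `(i, j)`, which is the bit `h` for the cell on the left
(`exists_stepFlow`).  Hence `Y⁺ 𝐏` is the output of a configuration of a vertex model on `ℤ²` in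
which no bits enter from far below or from the far right (`exists_isFlow_flowRed`), and such a
configuration is unique (`IsFlow.unique`).

Written out, the rules for the upward red bit and the leftward black bit, and likewise those for the
red and the black output, are the same Boolean functions `carryOut` and `depositOut` with the colours
and the directions exchanged.  So the model for `𝐏†` is the transpose of the one for `𝐏`
(`IsFlow.transpose`).  Since `X⁺ 𝐏 = (Y⁺ 𝐏†)†`, the output of cell `(i, j)` is found at `(i, j + 1)`
in `Y⁺ 𝐏` and, being the same, at `(i + 1, j)` in `X⁺ 𝐏`; the shift `σ` takes the first position to
the second.
-/

namespace PipeDream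

theorem mem_transpose (P : PipeDream) (i j : ℤ) :
    (i, j) ∈ P.transpose.cells ↔ (j, i) ∈ P.cells := by
  simp [transpose, move]

theorem mem_shift (P : PipeDream) (i j : ℤ) :
    (i, j) ∈ P.shift.cells ↔ (i - 1, j + 1) ∈ P.cells := by
  simp only [shift, move, Finset.mem_image, Prod.mk.injEq]
  constructor
  · rintro ⟨⟨a, b⟩, h, rfl, rfl⟩
    simpa using h
  · exact fun h => ⟨_, h, by simp⟩

end PipeDream

namespace SuperPipeDream

/-! ### The local rules -/

/-- The bit that leaves a cell of the vertex model along one of its two directions.  The cell holds a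
checker of the flowing colour iff `r`, and one of the other colour iff `b`; a flowing checker enters
it iff `v`, and one of the other colour enters along the other direction iff `h`.  A flowing checker
that enters passes an occupied cell; a flowing checker of the cell itself starts to move iff neither
bit enters.  With `v` from below and `h` from the right this is the red bit going up; exchanging the
colours, it is the black bit going left. -/
def carryOut (v h b r : Prop) : Prop := v ∧ (b ∨ r) ∨ ¬v ∧ r ∧ ¬h

/-- Whether a cell of the vertex model leaves a checker of the flowing colour at its output position,
in the notation of `carryOut`: a checker of the cell is left if some bit enters, and an entering one
comes to rest if the cell is empty. -/
def depositOut (v h b r : Prop) : Prop := r ∧ (v ∨ h) ∨ v ∧ ¬b ∧ ¬r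

/-! ### Membership after one ladder move -/

theorem swapColumns_involutive (j : ℤ) (R : ℤ → Prop) [DecidablePred R] :
    Function.Involutive (swapColumns j R) := by
  rintro ⟨i, k⟩
  unfold swapColumns
  grind

theorem mem_image_swapColumns (j : ℤ) (R : ℤ → Prop) [DecidablePred R] (s : Finset (ℤ × ℤ))
    (q : ℤ × ℤ) : q ∈ s.image (swapColumns j R) ↔ swapColumns j R q ∈ s := by
  have hinv := swapColumns_involutive j R
  constructor
  · intro hq
    obtain ⟨p, hp, rfl⟩ := Finset.mem_image.1 hq
    rwa [hinv p]
  · exact fun hq => Finset.mem_image.2 ⟨_, hq, hinv q⟩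

theorem mem_black_flowSmallLadder (P : SuperPipeDream) {i j : ℤ} (h : (i, j) ∈ P.red.cells)
    (q : ℤ × ℤ) : q ∈ (P.flowSmallLadder i j h).black.cells ↔
      swapColumns j (fun r => r = i) q ∈ P.black.cells :=
  mem_image_swapColumns j _ _ q

theorem mem_red_flowSmallLadder (P : SuperPipeDream) {i j : ℤ} (h : (i, j) ∈ P.red.cells)
    (q : ℤ × ℤ) : q ∈ (P.flowSmallLadder i j h).red.cells ↔
      swapColumns j (fun r => r = i) q ∈ P.red.cells :=
  mem_image_swapColumns j _ _ q

theorem mem_black_flowBigLadder (P : SuperPipeDream) {i j : ℤ} (h : (i, j) ∈ P.red.cells)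
    (q : ℤ × ℤ) : q ∈ (P.flowBigLadder i j h).black.cells ↔
      swapColumns j (fun r => P.emptyRowAbove i j < r ∧ r < i) q ∈ P.black.cells :=
  mem_image_swapColumns j _ _ q

theorem mem_red_flowBigLadder (P : SuperPipeDream) {i j : ℤ} (h : (i, j) ∈ P.red.cells)
    (q : ℤ × ℤ) : q ∈ (P.flowBigLadder i j h).red.cells ↔
      q = (P.emptyRowAbove i j, j + 1) ∨ q ≠ (i, j) ∧
        swapColumns j (fun r => P.emptyRowAbove i j < r ∧ r < i) q ∈ P.red.cells := by
  have hinv := swapColumns_involutive j (fun r => P.emptyRowAbove i j < r ∧ r < i)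
  have hfix : swapColumns j (fun r => P.emptyRowAbove i j < r ∧ r < i) (i, j) = (i, j) := by
    simp [swapColumns]
  simp only [flowBigLadder, PipeDream.move, Finset.mem_image]
  constructor
  · rintro ⟨p, hp, rfl⟩
    split_ifs with hpij
    · exact Or.inl rfl
    · refine Or.inr ⟨fun he => hpij ?_, by rwa [hinv p]⟩
      rw [← hinv p, he, hfix]
  · rintro (rfl | ⟨hne, hq⟩)
    · exact ⟨(i, j), h, if_pos rfl⟩
    · refine ⟨_, hq, ?_⟩
      rw [if_neg, hinv q]
      intro he
      apply hne
      rw [← hinv q, he, hfix]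

theorem emptyRowAbove_lt (P : SuperPipeDream) (i j : ℤ) : P.emptyRowAbove i j < i := by
  unfold emptyRowAbove
  omega

theorem emptyRowAbove_notMem_occupied (P : SuperPipeDream) (i j : ℤ) :
    (P.emptyRowAbove i j, j) ∉ P.occupied :=
  Nat.find_spec (P.exists_empty_above i j)

theorem mem_redRows (P : SuperPipeDream) {i j : ℤ} : i ∈ P.redRows j ↔ (i, j) ∈ P.red.cells := by
  refine ⟨P.mem_red_of_mem_redRows, fun h => ?_⟩
  exact Finset.mem_image.2 ⟨(i, j), Finset.mem_filter.2 ⟨h, rfl⟩, rfl⟩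

/-! ### Flowing a single column -/

/-- The rows `≥ t` of the columns `j` and `j + 1` of `P` have been treated, with result `Q`, and no red
checker is being carried past row `t`.  Here `v i` says that row `i` of column `j` passes a red
checker on to row `i - 1`.  The fields `carry`, `black_left`, `black_right` and `red_right` are the
local rules of the vertex model, the bit entering from the right being the black checker of `P` at
`(i, j + 1)`; everything else is as in `P`. -/
structure PartialFlow (j : ℤ) (P Q : SuperPipeDream) (t : ℤ) (v : ℤ → Prop) : Prop where
  carry_far : ∀ i, (∀ i' ≥ i, (i', j) ∉ P.red.cells) → ¬v i
  carry_above : ∀ i ≤ t, ¬v i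
  carry : ∀ i ≥ t, v i ↔ carryOut (v (i + 1)) ((i, j + 1) ∈ P.black.cells)
    ((i, j) ∈ P.black.cells) ((i, j) ∈ P.red.cells)
  black_left : ∀ i ≥ t, (i, j) ∈ Q.black.cells ↔ carryOut ((i, j + 1) ∈ P.black.cells) (v (i + 1))
    ((i, j) ∈ P.red.cells) ((i, j) ∈ P.black.cells)
  red_left : ∀ i ≥ t, (i, j) ∉ Q.red.cells
  black_right : ∀ i ≥ t, (i, j + 1) ∈ Q.black.cells ↔ depositOut ((i, j + 1) ∈ P.black.cells)
    (v (i + 1)) ((i, j) ∈ P.red.cells) ((i, j) ∈ P.black.cells)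
  red_right : ∀ i ≥ t, (i, j + 1) ∈ Q.red.cells ↔ depositOut (v (i + 1))
    ((i, j + 1) ∈ P.black.cells) ((i, j) ∈ P.black.cells) ((i, j) ∈ P.red.cells)
  black_above : ∀ i < t, ∀ k, (i, k) ∈ Q.black.cells ↔ (i, k) ∈ P.black.cells
  red_above : ∀ i < t, ∀ k, (i, k) ∈ Q.red.cells ↔ (i, k) ∈ P.red.cells
  black_other : ∀ i k, k ≠ j → k ≠ j + 1 → ((i, k) ∈ Q.black.cells ↔ (i, k) ∈ P.black.cells)
  red_other : ∀ i k, k ≠ j → k ≠ j + 1 → ((i, k) ∈ Q.red.cells ↔ (i, k) ∈ P.red.cells)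

/-- Rows without red checkers count as treated: nothing is carried through them, and the local rules
leave them alone. -/
theorem PartialFlow.raise {j : ℤ} {P Q : SuperPipeDream} {t s : ℤ} {v : ℤ → Prop}
    (hP : ∀ i, (i, j + 1) ∉ P.red.cells) (H : PartialFlow j P Q t v) (hst : s ≤ t)
    (hs : ∀ i ≥ s, (i, j) ∉ Q.red.cells) : PartialFlow j P Q s v := by
  have hr : ∀ i ≥ s, i < t → (i, j) ∉ P.red.cells := fun i h₁ h₂ => by
    rw [← H.red_above i h₂]; exact hs i h₁
  have h1 := H.carry
  have h2 := H.black_left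
  have h3 := H.black_right
  have h4 := H.red_right
  have h5 := H.carry_above
  have h6 := H.black_above
  have h7 := H.red_above
  refine ⟨H.carry_far, fun i hi => H.carry_above i (by omega), fun i hi => ?_, fun i hi => ?_,
    hs, fun i hi => ?_, fun i hi => ?_, fun i hi => H.black_above i (by omega),
    fun i hi => H.red_above i (by omega), H.black_other, H.red_other⟩ <;>
  rcases lt_or_ge i t with hit | hit
  · have := h5 i (by omega); have := h5 (i + 1) (by omega); have := hr i hi hit
    unfold carryOut; tauto
  · exact h1 i hit
  · have := h6 i hit j; have := h5 (i + 1) (by omega); have := hr i hi hit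
    unfold carryOut; tauto
  · exact h2 i hit
  · have := h6 i hit (j + 1); have := h5 (i + 1) (by omega); have := hr i hi hit
    unfold depositOut; tauto
  · exact h3 i hit
  · have := h7 i hit (j + 1); have := h5 (i + 1) (by omega); have := hr i hi hit
    have := hP i
    unfold depositOut; tauto
  · exact h4 i hit

/-- A move in a `1`-ladder treats the row of the ladder. -/
theorem PartialFlow.small {j : ℤ} {P Q : SuperPipeDream} {i₀ : ℤ} {v : ℤ → Prop}
    (hP : ∀ i, (i, j + 1) ∉ P.red.cells) (H : PartialFlow j P Q (i₀ + 1) v)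
    (h₀ : (i₀, j) ∈ Q.red.cells) (hocc : (i₀, j + 1) ∈ Q.occupied) :
    PartialFlow j P (Q.flowSmallLadder i₀ j h₀) i₀ v := by
  have ha : (i₀, j + 1) ∈ P.black.cells := by
    rcases Finset.mem_union.1 hocc with h | h
    · exact (H.black_above i₀ (by omega) _).1 h
    · exact absurd ((H.red_above i₀ (by omega) _).1 h) (hP i₀)
  have hr : (i₀, j) ∈ P.red.cells := (H.red_above i₀ (by omega) _).1 h₀
  have hv₁ := H.carry_above (i₀ + 1) le_rfl
  have hv₀ := H.carry_above i₀ (by omega)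
  have hb := H.black_above i₀ (by omega)
  have hd := H.red_above i₀ (by omega)
  have hP₀ := hP i₀
  refine ⟨H.carry_far, fun i hi => H.carry_above i (by omega), fun i hi => ?_, fun i hi => ?_,
    fun i hi => ?_, fun i hi => ?_, fun i hi => ?_, fun i hi k => ?_, fun i hi k => ?_,
    fun i k hk hk' => ?_, fun i k hk hk' => ?_⟩ <;>
  try simp only [mem_black_flowSmallLadder, mem_red_flowSmallLadder]
  · rcases hi.eq_or_lt with rfl | hi
    · unfold carryOut; tauto
    · exact H.carry i hi
  · rcases hi.eq_or_lt with rfl | hi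
    · simp [swapColumns, hb, carryOut, ha, hr]
    · simpa [swapColumns, hi.ne'] using H.black_left i hi
  · rcases hi.eq_or_lt with rfl | hi
    · simp [swapColumns, hd, hP]
    · simpa [swapColumns, hi.ne'] using H.red_left i hi
  · rcases hi.eq_or_lt with rfl | hi
    · simp [swapColumns, hb, depositOut, ha, hr]
    · simpa [swapColumns, hi.ne'] using H.black_right i hi
  · rcases hi.eq_or_lt with rfl | hi
    · simp [swapColumns, hd, depositOut, ha, hr]
    · simpa [swapColumns, hi.ne'] using H.red_right i hi
  · simpa [swapColumns, hi.ne] using H.black_above i (by omega) k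
  · simpa [swapColumns, hi.ne] using H.red_above i (by omega) k
  · simpa [swapColumns, hk, hk'] using H.black_other i k hk hk'
  · simpa [swapColumns, hk, hk'] using H.red_other i k hk hk'

/-- A move in a big ladder treats all the rows of the ladder: the bit `v` is switched on in the rows
that the moving checker leaves upwards. -/
theorem PartialFlow.big {j : ℤ} {P Q : SuperPipeDream} {i₀ : ℤ} {v : ℤ → Prop}
    (hP : ∀ i, (i, j + 1) ∉ P.red.cells) (H : PartialFlow j P Q (i₀ + 1) v)
    (h₀ : (i₀, j) ∈ Q.red.cells) (hocc : (i₀, j + 1) ∉ Q.occupied) :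
    PartialFlow j P (Q.flowBigLadder i₀ j h₀) (Q.emptyRowAbove i₀ j)
      (fun r => v r ∨ Q.emptyRowAbove i₀ j < r ∧ r ≤ i₀) := by
  have he := Q.emptyRowAbove_lt i₀ j
  have hemp := Q.emptyRowAbove_notMem_occupied i₀ j
  have hbet := fun r => Q.mem_occupied_of_between (i := i₀) (j := j) (r := r)
  have hmb := Q.mem_black_flowBigLadder h₀
  have hmr := Q.mem_red_flowBigLadder h₀
  set e := Q.emptyRowAbove i₀ j
  simp only [occupied, Finset.mem_union] at hocc hemp hbet
  have hb := fun i (hi : i ≤ i₀) => H.black_above i (by omega)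
  have hd := fun i (hi : i ≤ i₀) => H.red_above i (by omega)
  have hv := fun i (hi : i ≤ i₀ + 1) => H.carry_above i hi
  -- A treated row lies below the ladder, or at its bottom, inside it, or at its top.
  have key : ∀ i ≥ e, i₀ < i ∨ i = i₀ ∨ (e < i ∧ i < i₀) ∨ i = e := by intro i hi; omega
  have hr₀ := (hd i₀ le_rfl j).1 h₀
  rw [hb i₀ le_rfl, hd i₀ le_rfl] at hocc
  rw [hb e he.le, hd e he.le] at hemp
  have hbet' : ∀ r, e < r → r < i₀ → ((r, j) ∈ P.black.cells ∨ (r, j) ∈ P.red.cells) := by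
    intro r h1 h2
    rw [← hb r h2.le, ← hd r h2.le]; exact hbet r h1 h2
  clear hbet
  refine ⟨fun i hi => ?_, fun i hi => ?_, fun i hi => ?_, fun i hi => ?_,
    fun i hi => ?_, fun i hi => ?_, fun i hi => ?_, fun i hi k => ?_, fun i hi k => ?_,
    fun i k hk hk' => ?_, fun i k hk hk' => ?_⟩ <;>
  try simp only [hmb, hmr]
  · rintro (h | h)
    · exact H.carry_far i hi h
    · exact hi i₀ h.2 hr₀
  · rintro (h | h)
    · exact hv i (by omega) h
    · omega
  · have := H.carry i
    rcases key i hi with h | rfl | h | rfl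
    · rw [this h]; simp [carryOut, h.not_ge, show ¬i + 1 ≤ i₀ by omega]
    · simp_all [carryOut]
    · have := hv i (by omega); have hbi := hbet' i h.1 h.2; clear hbet'
      simp_all [carryOut, h.2.le, show e < i + 1 by omega, show i + 1 ≤ i₀ by omega]
    · have := hv e (by omega)
      simp_all [carryOut, show e + 1 ≤ i₀ by omega]
  · rcases key i hi with h | rfl | h | rfl
    · simpa [swapColumns, h.not_gt, show ¬i + 1 ≤ i₀ by omega] using H.black_left i h
    · simp_all [swapColumns, carryOut]
    · have hbi := hbet' i h.1 h.2; clear hbet'; have := hb i h.2.le (j + 1)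
      simp_all [swapColumns, carryOut, show e < i + 1 by omega, show i + 1 ≤ i₀ by omega]
      tauto
    · have := hb e he.le j
      simp_all [swapColumns, carryOut, show e + 1 ≤ i₀ by omega]
  · rcases key i hi with h | rfl | h | rfl
    · simpa [swapColumns, h.not_gt] using fun _ => H.red_left i h
    · simp
    · simp_all [swapColumns, h.2.le]
    · simp_all [swapColumns, he.le]
  · rcases key i hi with h | rfl | h | rfl
    · simpa [swapColumns, h.not_gt, show ¬i + 1 ≤ i₀ by omega] using H.black_right i h
    · simp_all [swapColumns, depositOut]
    · have hbi := hbet' i h.1 h.2; clear hbet'; have := hb i h.2.le j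
      simp_all [swapColumns, depositOut, show e < i + 1 by omega, show i + 1 ≤ i₀ by omega]
      tauto
    · have := hb e he.le (j + 1)
      simp_all [swapColumns, depositOut, show e + 1 ≤ i₀ by omega]
  · rcases key i hi with h | rfl | h | rfl
    · simpa [swapColumns, h.not_gt, show ¬i + 1 ≤ i₀ by omega, show i ≠ e by omega]
        using H.red_right i h
    · simp_all [swapColumns, depositOut, he.ne']
    · have hbi := hbet' i h.1 h.2; clear hbet'; have := hd i h.2.le j
      simp_all [swapColumns, depositOut, h.1.ne', show e < i + 1 by omega,
        show i + 1 ≤ i₀ by omega]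
      tauto
    · have := hd e he.le (j + 1)
      simp_all [swapColumns, depositOut, show e + 1 ≤ i₀ by omega]
  · simpa [swapColumns, hi.not_gt] using hb i (by omega) k
  · have := hd i (by omega) k
    simpa [swapColumns, hi.not_gt, hi.ne, show i ≠ i₀ by omega] using this
  · simpa [swapColumns, hk, hk'] using H.black_other i k hk hk'
  · simpa [swapColumns, hk, hk'] using H.red_other i k hk hk'

theorem redRows_card_lt {j i₀ t : ℤ} {P Q Q' : SuperPipeDream} {v v' : ℤ → Prop} {s : ℤ}
    (H : PartialFlow j P Q s v) (H' : PartialFlow j P Q' t v') (h₀ : (i₀, j) ∈ Q.red.cells)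
    (hs : i₀ < s) (ht : t ≤ i₀) : (Q'.redRows j).card < (Q.redRows j).card := by
  refine Finset.card_lt_card ((Finset.ssubset_iff_of_subset fun i hi => ?_).2
    ⟨i₀, Q.mem_redRows.2 h₀, fun h => H'.red_left i₀ ht (Q'.mem_redRows.1 h)⟩)
  rw [mem_redRows] at hi ⊢
  have hit : i < t := by
    by_contra hit
    exact H'.red_left i (by omega) hi
  rw [H.red_above i (by omega)]
  exact (H'.red_above i hit j).1 hi

/-- As many rounds as there are red checkers in column `j` suffice, since every round lowers their
number. -/
theorem PartialFlow.iterate {j : ℤ} {P : SuperPipeDream} (hP : ∀ i, (i, j + 1) ∉ P.red.cells)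
    (n : ℕ) : ∀ {Q : SuperPipeDream} {t : ℤ} {v : ℤ → Prop}, PartialFlow j P Q t v →
    (Q.redRows j).card ≤ n → ∃ t v, PartialFlow j P ((flowLowest j)^[n] Q) t v ∧
      ∀ i, (i, j) ∉ ((flowLowest j)^[n] Q).red.cells := by
  induction n with
  | zero =>
    intro Q t v H hn
    refine ⟨t, v, H, fun i hi => ?_⟩
    have := Finset.card_eq_zero.1 (Nat.le_zero.1 hn)
    simpa [this] using Q.mem_redRows.2 hi
  | succ n ih =>
    intro Q t v H hn
    rw [Function.iterate_succ_apply]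
    by_cases hne : (Q.redRows j).Nonempty
    · have hmax := Finset.max'_mem _ hne
      have h₀ := Q.mem_red_of_mem_redRows hmax
      have hlow : ∀ i ≥ (Q.redRows j).max' hne + 1, (i, j) ∉ Q.red.cells := fun i hi h => by
        have := Finset.le_max' _ i (Q.mem_redRows.2 h)
        omega
      have hlt : (Q.redRows j).max' hne < t := by
        by_contra hge
        exact H.red_left _ (by omega) h₀
      have H₁ := H.raise hP (by omega) hlow
      rw [flowLowest, dif_pos hne]
      split_ifs with hocc
      · have H₂ := H₁.small hP h₀ hocc
        have := redRows_card_lt H₁ H₂ h₀ (by omega) le_rfl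
        exact ih H₂ (by omega)
      · have H₂ := H₁.big hP h₀ hocc
        have := redRows_card_lt H₁ H₂ h₀ (by omega) (Q.emptyRowAbove_lt _ _).le
        exact ih H₂ (by omega)
    · rw [flowLowest, dif_neg hne]
      refine ih H ?_
      rw [Finset.not_nonempty_iff_eq_empty.1 hne]
      simp

/-- `Q` arises from `P` by flowing the red checkers of column `j` through the cells of that column,
according to the local rules of the vertex model; `v i` is the red bit that leaves row `i` upwards.
This is `PartialFlow` for every threshold at once. -/
structure StepFlow (j : ℤ) (P Q : SuperPipeDream) (v : ℤ → Prop) : Prop where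
  carry_far : ∀ i, (∀ i' ≥ i, (i', j) ∉ P.red.cells) → ¬v i
  carry : ∀ i, v i ↔ carryOut (v (i + 1)) ((i, j + 1) ∈ P.black.cells)
    ((i, j) ∈ P.black.cells) ((i, j) ∈ P.red.cells)
  black_left : ∀ i, (i, j) ∈ Q.black.cells ↔ carryOut ((i, j + 1) ∈ P.black.cells) (v (i + 1))
    ((i, j) ∈ P.red.cells) ((i, j) ∈ P.black.cells)
  red_left : ∀ i, (i, j) ∉ Q.red.cells
  black_right : ∀ i, (i, j + 1) ∈ Q.black.cells ↔ depositOut ((i, j + 1) ∈ P.black.cells)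
    (v (i + 1)) ((i, j) ∈ P.red.cells) ((i, j) ∈ P.black.cells)
  red_right : ∀ i, (i, j + 1) ∈ Q.red.cells ↔ depositOut (v (i + 1))
    ((i, j + 1) ∈ P.black.cells) ((i, j) ∈ P.black.cells) ((i, j) ∈ P.red.cells)
  black_other : ∀ i k, k ≠ j → k ≠ j + 1 → ((i, k) ∈ Q.black.cells ↔ (i, k) ∈ P.black.cells)
  red_other : ∀ i k, k ≠ j → k ≠ j + 1 → ((i, k) ∈ Q.red.cells ↔ (i, k) ∈ P.red.cells)

theorem exists_lt_fst (s : Finset (ℤ × ℤ)) : ∃ N : ℤ, ∀ p ∈ s, p.1 < N := by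
  obtain ⟨N, hN⟩ := (s.image Prod.fst).bddAbove
  exact ⟨N + 1, fun p hp => Int.lt_add_one_of_le (hN (by simpa using ⟨p.2, hp⟩))⟩

theorem exists_stepFlow {j : ℤ} {P : SuperPipeDream} (hP : ∀ i, (i, j + 1) ∉ P.red.cells) :
    ∃ v, StepFlow j P (flowRedStep j P) v := by
  obtain ⟨N, hN⟩ := exists_lt_fst P.occupied
  have hb : ∀ i ≥ N, ∀ k, (i, k) ∉ P.black.cells := fun i hi k h =>
    (hN _ (Finset.mem_union_left _ h)).not_ge hi
  have hr : ∀ i ≥ N, ∀ k, (i, k) ∉ P.red.cells := fun i hi k h =>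
    (hN _ (Finset.mem_union_right _ h)).not_ge hi
  have H₀ : PartialFlow j P P N (fun _ => False) := by
    constructor <;> simp +contextual [carryOut, depositOut, hb, hr]
  obtain ⟨t, v, H, hfree⟩ := PartialFlow.iterate hP _ H₀ le_rfl
  change PartialFlow j P (flowRedStep j P) t v at H
  change ∀ i, (i, j) ∉ (flowRedStep j P).red.cells at hfree
  -- `raise` lets the threshold drop to any given row.
  have hall : ∀ i, PartialFlow j P (flowRedStep j P) (min t i) v := fun i =>
    H.raise hP (min_le_left _ _) fun i _ => hfree i
  exact ⟨v, H.carry_far, fun i => (hall i).carry i (min_le_right _ _),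
    fun i => (hall i).black_left i (min_le_right _ _), hfree,
    fun i => (hall i).black_right i (min_le_right _ _),
    fun i => (hall i).red_right i (min_le_right _ _), H.black_other, H.red_other⟩

/-! ### The vertex model -/

/-- A configuration of the vertex model on `ℤ²`.  Cell `(i, j)` holds a black checker iff `b i j` and a
red one iff `r i j`.  The bit `v i j` leaves it upwards, to cell `(i - 1, j)`, and `h i j` leaves it
leftwards, to cell `(i, j - 1)`; the outputs of the cell are `b' i j` and `r' i j`.  No bits enter
from far below or from far to the right. -/
structure IsFlow (b r v h b' r' : ℤ → ℤ → Prop) : Prop where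
  vertical : ∀ i j, v i j ↔ carryOut (v (i + 1) j) (h i (j + 1)) (b i j) (r i j)
  horizontal : ∀ i j, h i j ↔ carryOut (h i (j + 1)) (v (i + 1) j) (r i j) (b i j)
  black : ∀ i j, b' i j ↔ depositOut (h i (j + 1)) (v (i + 1) j) (r i j) (b i j)
  red : ∀ i j, r' i j ↔ depositOut (v (i + 1) j) (h i (j + 1)) (b i j) (r i j)
  vertical_far : ∃ N, ∀ i ≥ N, ∀ j, ¬v i j
  horizontal_far : ∃ N, ∀ j ≥ N, ∀ i, ¬h i j

/-- The local rules are symmetric under transposition together with exchange of the colours. -/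
theorem IsFlow.transpose {b r v h b' r' : ℤ → ℤ → Prop} (H : IsFlow b r v h b' r') :
    IsFlow (fun i j => r j i) (fun i j => b j i) (fun i j => h j i) (fun i j => v j i)
      (fun i j => r' j i) (fun i j => b' j i) :=
  ⟨fun i j => H.horizontal j i, fun i j => H.vertical j i, fun i j => H.red j i,
    fun i j => H.black j i, H.horizontal_far, H.vertical_far⟩

/-- The bits, and with them the outputs, are determined by the contents of the cells: row by row from
below, and in each row from right to left. -/
theorem IsFlow.unique {b r v₁ h₁ b₁ r₁ v₂ h₂ b₂ r₂ : ℤ → ℤ → Prop}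
    (H₁ : IsFlow b r v₁ h₁ b₁ r₁) (H₂ : IsFlow b r v₂ h₂ b₂ r₂) : b₁ = b₂ ∧ r₁ = r₂ := by
  obtain ⟨M₁, hM₁⟩ := H₁.vertical_far
  obtain ⟨M₂, hM₂⟩ := H₂.vertical_far
  obtain ⟨N₁, hN₁⟩ := H₁.horizontal_far
  obtain ⟨N₂, hN₂⟩ := H₂.horizontal_far
  have hrow : ∀ i, (∀ j, v₁ (i + 1) j ↔ v₂ (i + 1) j) → ∀ j, h₁ i j ↔ h₂ i j := by
    intro i hi j
    rcases le_total j (max N₁ N₂) with hj | hj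
    · induction j, hj using Int.leInductionDown with
      | base => simp [hN₁ _ (le_max_left N₁ N₂), hN₂ _ (le_max_right N₁ N₂)]
      | pred j _ ih =>
        rw [H₁.horizontal, H₂.horizontal, sub_add_cancel, ih, hi]
    · simp [hN₁ j ((le_max_left _ _).trans hj), hN₂ j ((le_max_right _ _).trans hj)]
  have hv : ∀ i j, v₁ i j ↔ v₂ i j := by
    intro i
    rcases le_total i (max M₁ M₂) with hi | hi
    · induction i, hi using Int.leInductionDown with
      | base => simp [hM₁ _ (le_max_left M₁ M₂), hM₂ _ (le_max_right M₁ M₂)]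
      | pred i _ ih =>
        intro j
        rw [H₁.vertical, H₂.vertical, hrow (i - 1) (by simpa using ih), sub_add_cancel, ih]
    · simp [hM₁ i ((le_max_left _ _).trans hi), hM₂ i ((le_max_right _ _).trans hi)]
  have hh : ∀ i j, h₁ i j ↔ h₂ i j := fun i => hrow i (hv (i + 1))
  refine ⟨?_, ?_⟩ <;> ext i j
  · rw [H₁.black, H₂.black, hv, hh]
  · rw [H₁.red, H₂.red, hv, hh]

/-! ### The red flow is a configuration of the vertex model -/

theorem notMem_red_of_redBound_lt (P : SuperPipeDream) {i j : ℤ} (hj : P.redBound < j.natAbs) :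
    (i, j) ∉ P.red.cells := fun h => by
  have h₁ : j.natAbs ≤ P.redBound := Finset.le_sup (f := fun p : ℤ × ℤ => p.2.natAbs) h
  omega

theorem flowRedStep_of_forall_notMem {j : ℤ} {P : SuperPipeDream}
    (h : ∀ i, (i, j) ∉ P.red.cells) : flowRedStep j P = P := by
  have he : P.redRows j = ∅ := Finset.eq_empty_of_forall_notMem fun i hi => h i (P.mem_redRows.1 hi)
  simp [flowRedStep, he]

theorem flowRedFrom_eq_self (P : SuperPipeDream) {j : ℤ} (hj : (P.redBound : ℤ) < j) :
    flowRedFrom j P = P := by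
  rw [flowRedFrom, Int.toNat_of_nonpos (by omega)]
  rfl

/-- This holds for every `j`: beyond the bound on the red columns, both sides are `P`. -/
theorem flowRedFrom_eq_flowRedStep (P : SuperPipeDream) (j : ℤ) :
    flowRedFrom j P = flowRedStep j (flowRedFrom (j + 1) P) := by
  rcases le_or_gt j P.redBound with hj | hj
  · unfold flowRedFrom
    rw [show ((P.redBound : ℤ) + 1 - j).toNat = ((P.redBound : ℤ) + 1 - (j + 1)).toNat + 1 by omega]
    rfl
  · rw [flowRedFrom_eq_self P hj, flowRedFrom_eq_self P (by omega), flowRedStep_of_forall_notMem]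
    exact fun i => P.notMem_red_of_redBound_lt (by omega)

/-- After the columns `≥ j` have been treated, column `j` has no red checkers, as the next step
needs, and the columns to the left of it are still those of `P`. -/
theorem flowRedFrom_invariant (P : SuperPipeDream) (j : ℤ) :
    (∀ i, (i, j) ∉ (flowRedFrom j P).red.cells) ∧ ∀ i, ∀ k < j,
      ((i, k) ∈ (flowRedFrom j P).black.cells ↔ (i, k) ∈ P.black.cells) ∧
      ((i, k) ∈ (flowRedFrom j P).red.cells ↔ (i, k) ∈ P.red.cells) := by
  have hlarge : ∀ j > (P.redBound : ℤ), (∀ i, (i, j) ∉ (flowRedFrom j P).red.cells) ∧ ∀ i, ∀ k < j,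
      ((i, k) ∈ (flowRedFrom j P).black.cells ↔ (i, k) ∈ P.black.cells) ∧
      ((i, k) ∈ (flowRedFrom j P).red.cells ↔ (i, k) ∈ P.red.cells) := by
    intro j hj
    rw [flowRedFrom_eq_self P hj]
    exact ⟨fun i => P.notMem_red_of_redBound_lt (by omega), fun _ _ _ => ⟨Iff.rfl, Iff.rfl⟩⟩
  rcases le_total j (P.redBound + 1) with hj | hj
  · induction j, hj using Int.leInductionDown with
    | base => exact hlarge _ (by omega)
    | pred j _ ih =>
      have e := flowRedFrom_eq_flowRedStep P (j - 1)
      rw [sub_add_cancel] at e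
      obtain ⟨v, H⟩ := exists_stepFlow (j := j - 1) (P := flowRedFrom j P)
        (by simpa using ih.1)
      rw [← e] at H
      refine ⟨H.red_left, fun i k hk => ⟨?_, ?_⟩⟩
      · rw [H.black_other i k (by omega) (by omega)]
        exact (ih.2 i k (by omega)).1
      · rw [H.red_other i k (by omega) (by omega)]
        exact (ih.2 i k (by omega)).2
  · exact hlarge _ (by omega)

theorem exists_stepFlow_flowRedFrom (P : SuperPipeDream) (j : ℤ) :
    ∃ v, StepFlow j (flowRedFrom (j + 1) P) (flowRedFrom j P) v := by
  rw [flowRedFrom_eq_flowRedStep P j]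
  exact exists_stepFlow (flowRedFrom_invariant P (j + 1)).1

/-- Column `k + 1` is final once column `k` has been treated. -/
theorem flowRedFrom_settled (P : SuperPipeDream) {j k : ℤ} (hjk : j ≤ k) (i : ℤ) :
    ((i, k + 1) ∈ (flowRedFrom j P).black.cells ↔ (i, k + 1) ∈ (flowRedFrom k P).black.cells) ∧
    ((i, k + 1) ∈ (flowRedFrom j P).red.cells ↔ (i, k + 1) ∈ (flowRedFrom k P).red.cells) := by
  induction j, hjk using Int.leInductionDown with
  | base => exact ⟨Iff.rfl, Iff.rfl⟩
  | pred j hj ih =>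
    obtain ⟨v, H⟩ := exists_stepFlow_flowRedFrom P (j - 1)
    rw [sub_add_cancel] at H
    rw [H.black_other i _ (by omega) (by omega), H.red_other i _ (by omega) (by omega)]
    exact ih

theorem flowRedFrom_eq_flowRed (P : SuperPipeDream) {j : ℤ} (hj : j ≤ -(P.redBound : ℤ)) :
    flowRedFrom j P = P.flowRed := by
  induction j, hj using Int.leInductionDown with
  | base => rfl
  | pred j hj ih =>
    rw [flowRedFrom_eq_flowRedStep, sub_add_cancel, flowRedStep_of_forall_notMem, ih]
    intro i
    rw [((flowRedFrom_invariant P j).2 i (j - 1) (by omega)).2]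
    exact P.notMem_red_of_redBound_lt (by omega)

theorem mem_flowRed_succ (P : SuperPipeDream) (i j : ℤ) :
    ((i, j + 1) ∈ P.flowRed.black.cells ↔ (i, j + 1) ∈ (flowRedFrom j P).black.cells) ∧
    ((i, j + 1) ∈ P.flowRed.red.cells ↔ (i, j + 1) ∈ (flowRedFrom j P).red.cells) := by
  rw [← flowRedFrom_eq_flowRed P (min_le_left _ j)]
  exact flowRedFrom_settled P (min_le_right _ _) i

/-- The bit `h i j` records whether `(i, j)` holds a black checker just after column `j` has been
treated: this is what column `j - 1` then meets on its right.  The output of cell `(i, j)` is found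
at `(i, j + 1)`. -/
theorem exists_isFlow_flowRed (P : SuperPipeDream) :
    ∃ v h, IsFlow (fun i j => (i, j) ∈ P.black.cells) (fun i j => (i, j) ∈ P.red.cells) v h
      (fun i j => (i, j + 1) ∈ P.flowRed.black.cells)
      (fun i j => (i, j + 1) ∈ P.flowRed.red.cells) := by
  choose v H using exists_stepFlow_flowRedFrom P
  have hP := fun i j => (flowRedFrom_invariant P (j + 1)).2 i j (lt_add_one j)
  obtain ⟨M, hM⟩ := exists_lt_fst P.red.cells
  obtain ⟨N, hN⟩ := exists_lt_fst (P.black.cells.image Prod.swap)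
  refine ⟨fun i j => v j i, fun i j => (i, j) ∈ (flowRedFrom j P).black.cells,
    fun i j => ?_, fun i j => ?_, fun i j => ?_, fun i j => ?_, ⟨M, fun i hi j => ?_⟩,
    ⟨max N (P.redBound + 1), fun j hj i hmem => ?_⟩⟩
  · simpa only [hP] using (H j).carry i
  · simpa only [hP] using (H j).black_left i
  · simpa only [hP, mem_flowRed_succ] using (H j).black_right i
  · simpa only [hP, mem_flowRed_succ] using (H j).red_right i
  · refine (H j).carry_far i fun i' hi' => ?_
    rw [(hP i' j).2]
    exact fun h => (hM _ h).not_ge (hi.trans hi')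
  · rw [flowRedFrom_eq_self P (by omega)] at hmem
    have : j < N := hN (j, i) (Finset.mem_image.2 ⟨_, hmem, rfl⟩)
    omega

/-! ### The black flow as an adjoint -/

theorem adjoint_adjoint (P : SuperPipeDream) : P.adjoint.adjoint = P := by
  ext ⟨i, j⟩ <;> simp [adjoint, PipeDream.mem_transpose]

theorem redBound_adjoint (P : SuperPipeDream) : P.adjoint.redBound = P.blackBound := by
  simp [redBound, blackBound, adjoint, PipeDream.transpose, PipeDream.move, Finset.sup_image,
    Function.comp_def]

theorem composeSteps_flowBlackStep (n : ℕ) (i : ℤ) (P : SuperPipeDream) :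
    composeSteps flowBlackStep i n P = (composeSteps flowRedStep i n P.adjoint).adjoint := by
  induction n generalizing i with
  | zero => exact P.adjoint_adjoint.symm
  | succ n ih => simp only [composeSteps, ih, flowBlackStep, adjoint_adjoint]

theorem flowBlack_eq (P : SuperPipeDream) : P.flowBlack = P.adjoint.flowRed.adjoint := by
  simp only [flowBlack, flowBlackFrom, flowRed, flowRedFrom, redBound_adjoint,
    composeSteps_flowBlackStep]

end SuperPipeDream

theorem proposition5p1 (P : SuperPipeDream) : P.flowRed.shift = P.flowBlack := by
  obtain ⟨v, h, H⟩ := SuperPipeDream.exists_isFlow_flowRed P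
  obtain ⟨v', h', H'⟩ := SuperPipeDream.exists_isFlow_flowRed P.adjoint
  simp only [SuperPipeDream.adjoint, PipeDream.mem_transpose] at H'
  obtain ⟨hb, hr⟩ := H.unique H'.transpose
  rw [SuperPipeDream.flowBlack_eq]
  ext ⟨i, j⟩
  · have := congrFun₂ hb (i - 1) j
    simpa [SuperPipeDream.shift, SuperPipeDream.adjoint, PipeDream.mem_shift, PipeDream.mem_transpose]
      using this
  · have := congrFun₂ hr (i - 1) j
    simpa [SuperPipeDream.shift, SuperPipeDream.adjoint, PipeDream.mem_shift, PipeDream.mem_transpose]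
      using this
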